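/- **Theorem 5.3.** All manifolds, maps, forms and actions are smooth. A *Pfaffian system* of rank $r$ on a manifold $M$ is a rank $r$ sub-bundle $I\subset T^*M$; $\operatorname{ann}(I)\subset TM$ is its annihilator; $I^\infty_x=\{dF_x : F \text{ a function defined near } x \text{ with } dF\in I\}$; and $I'_x=\operatorname{span}\{\theta_x : \theta \text{ a section of } I,\ d\theta\equiv 0 \bmod I\}$. An *integral manifold* of $I$ is an immersion $s:N\to M$ with $s^*I=0$; it is an *integral curve* if $N$ is an open interval. A system $I$ is *hyperbolic of class $s\ge 2$*, with *singular systems* $\hat V,\check V$, if about each point of $M$ there is a local coframe $\theta^1,\dots,\theta^s,\hat\omega,\hat\pi,\check\omega,\check\pi$ with $$I=\operatorname{span}\{\theta^i\},\qquad \hat V=\operatorname{span}\{\theta^i,\hat\pi,\hat\omega\},\qquad \check V=\operatorname{span}\{\theta^i,\check\pi,\check\omega\},$$ $$d\theta^i\equiv 0\ (1\le i\le s-2),\qquad d\theta^{s-1}\equiv\hat\omega\wedge\hat\pi,\qquad d\theta^s\equiv\check\omega\wedge\check\pi \pmod I .$$ It is *Darboux integrable* if $I^\infty=0$, $\hat V+\check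 V^\infty=T^*M$ and $\hat V^\infty+\check V=T^*M$. An integral curve $\gamma$ of such an $I$ is *non-characteristic* if $\dot\gamma(t)\notin\operatorname{ann}(\hat V)$ and $\dot\gamma(t)\notin\operatorname{ann}(\check V)$ for all $t$. Let a Lie group $G$ act on manifolds $M_1$ and $M_2$ freely and regularly (regularly means: the quotient is a manifold and the quotient map $\mathbf q$ is a submersion), and let $K_i\subset T^*M_i$ $(i=1,2)$ be Pfaffian systems of codimension $2$, i.e. of rank $\dim M_i-2$, with $K_i^\infty=0$, such that $g^*K_i=K_i$ for all $g\in G$ and $G$ acts transversally to $K_i$; here an action with quotient map $\mathbf q$ is *transversal* to $K$ if $\ker(\mathbf q_*)\cap\operatorname{ann}(K)=0$. Write $K_1+K_2=\pi_1^*K_1+\pi_2^*K_2$ on $M_1\times M_2$, where $\pi_i:M_1\times M_2\to M_i$ are the projections (and similarly for $K_1'+K_2'$), and suppose that the diagonal action $G_{\rm diag}$ on $M_1\times M_2$ is regular and transversal to $K_1'+K_2'$. Let $\mathbf q_{G_{\rm diag}}:M_1\times M_2\to M=(M_1\times M_2)/G_{\rm diag}$ be the quotient map, and let $I$ be a Darboux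 integrable hyperbolic Pfaffian system on $M$ with canonical quotient representation $(K_1+K_2)/G_{\rm diag}$, that is, $$I=(K_1+K_2)/G_{\rm diag}=\{\bar\theta\in T^*M : \mathbf q_{G_{\rm diag}}^*\bar\theta\in K_1+K_2\}.$$ Let $\gamma:(a,b)\to M$, $-\infty\le a<b\le\infty$, be a non-characteristic integral curve of $I$, let $\sigma:(a,b)\to M_1\times M_2$ be a lift of $\gamma$ (that is, $\mathbf q_{G_{\rm diag}}\circ\sigma=\gamma$) which is an integral curve of $K_1+K_2$, and let $\sigma_i=\pi_i\circ\sigma$. Then the map $$s:(a,b)\times(a,b)\to M,\qquad s(t_1,t_2)=\mathbf q_{G_{\rm diag}}\big(\sigma_1(t_1),\sigma_2(t_2)\big),$$ solves the Cauchy problem for $\gamma$: it is a (smooth, immersed) $2$-dimensional integral manifold of $I$, and $\gamma((a,b))\subset s((a,b)\times(a,b))$. -/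

import Mathlib

open scoped Manifold ContDiff Topology

/-! Pfaffian systems on smooth real manifolds without boundary. -/

noncomputable section

namespace Pfaff

section Forms

variable {E : Type*} [NormedAddCommGroup E] [NormedSpace ℝ E]
  {H : Type*} [TopologicalSpace H] (I : ModelWithCorners ℝ E H)
  {M : Type*} [TopologicalSpace M] [ChartedSpace H M]

/-- The cotangent space `T*_x M`. -/
abbrev Cotangent (x : M) : Type _ := TangentSpace I x →L[ℝ] ℝ

/-- A (not necessarily smooth) differential one-form on `M`. -/
abbrev OneForm (M : Type*) [TopologicalSpace M] [ChartedSpace H M] : Type _ :=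
  (x : M) → Cotangent I x

/-- A field of subspaces of the cotangent spaces, i.e. a (not necessarily smooth, not necessarily
constant rank) subset `K ⊆ T*M` which is linear in each fibre. -/
abbrev CotangentSystem (M : Type*) [TopologicalSpace M] [ChartedSpace H M] : Type _ :=
  (x : M) → Submodule ℝ (Cotangent I x)

variable {I}

/-- The expression of the one-form `θ` in the preferred coordinates around `x`, i.e. the pullback of
`θ` by the inverse of the chart at `x`; a one-form on (an open subset of) the model space `E`. -/
def coordForm (θ : OneForm I M) (x : M) : E → E →L[ℝ] ℝ :=
  fun y ↦ (θ ((extChartAt I x).symm y)).comp (mfderiv 𝓘(ℝ, E) I (extChartAt I x).symm y)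

/-- `θ` is a smooth one-form on the open set `U`: its coordinate expression is smooth around
each point of `U`. -/
def SmoothFormOn (θ : OneForm I M) (U : Set M) : Prop :=
  ∀ x ∈ U, ContDiffAt ℝ ∞ (coordForm θ x) (extChartAt I x x)

/-- The exterior derivative `(dθ)_x(u, v)`, computed in the preferred coordinates around `x` (in
which `T_x M` is `E` itself), through the exterior derivative on the vector space `E`. -/
def dForm (θ : OneForm I M) (x : M) (u v : TangentSpace I x) : ℝ :=
  extDeriv (fun y : E ↦ ContinuousAlternatingMap.ofSubsingleton ℝ E ℝ (0 : Fin 1) (coordForm θ x y))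
    (extChartAt I x x) ![(u : E), (v : E)]

/-- The wedge product `(α ∧ β)(u, v)` of two covectors. -/
def wedge {x : M} (α β : Cotangent I x) (u v : TangentSpace I x) : ℝ :=
  α u * β v - α v * β u

/-- `ann(K)_x`, the vectors at `x` annihilated by `K`. -/
def ann (K : CotangentSystem I M) (x : M) : Submodule ℝ (TangentSpace I x) where
  carrier := {v | ∀ θ ∈ K x, θ v = 0}
  zero_mem' := fun θ _ ↦ map_zero θ
  add_mem' := fun {u v} hu hv θ hθ ↦ by rw [map_add, hu θ hθ, hv θ hθ, add_zero]
  smul_mem' := fun c v hv θ hθ ↦ by rw [map_smul, hv θ hθ, smul_zero]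

/-- Two bilinear alternating forms on `T_x M` are congruent modulo (the ideal generated by) `K_x`,
i.e. their restrictions to `ann(K)_x` agree. -/
def ModEq (K : CotangentSystem I M) (x : M) (A B : TangentSpace I x → TangentSpace I x → ℝ) :
    Prop :=
  ∀ u ∈ ann K x, ∀ v ∈ ann K x, A u v = B u v

/-- `K` is a Pfaffian system of constant rank `r`, i.e. a smooth rank `r` sub-bundle of `T*M`:
around each point there are `r` pointwise linearly independent smooth one-forms spanning `K`. -/
def IsPfaffianOfRank (K : CotangentSystem I M) (r : ℕ) : Prop :=
  ∀ x : M, ∃ U : Set M, IsOpen U ∧ x ∈ U ∧ ∃ θ : Fin r → OneForm I M,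
    (∀ i, SmoothFormOn (θ i) U) ∧
    ∀ y ∈ U, LinearIndependent ℝ (fun i ↦ θ i y) ∧
      K y = Submodule.span ℝ (Set.range fun i ↦ θ i y)

/-- `F : U → ℝ` is a local first integral of `K`: it is smooth on the open set `U` and
`dF` takes values in `K`. -/
def IsLocalFirstIntegral (K : CotangentSystem I M) (U : Set M) (F : M → ℝ) : Prop :=
  IsOpen U ∧ ContMDiffOn I 𝓘(ℝ, ℝ) ∞ F U ∧
    ∀ y ∈ U, (mfderiv I 𝓘(ℝ, ℝ) F y : TangentSpace I y →L[ℝ] ℝ) ∈ K y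

/-- The space of first integrals `K^∞`: the differentials at `x` of the local first integrals
defined about `x` (these covectors already form a subspace). -/
def firstIntegrals (K : CotangentSystem I M) : CotangentSystem I M := fun x ↦
  Submodule.span ℝ {α : Cotangent I x | ∃ (U : Set M) (F : M → ℝ), x ∈ U ∧
    IsLocalFirstIntegral K U F ∧ α = (mfderiv I 𝓘(ℝ, ℝ) F x : TangentSpace I x →L[ℝ] ℝ)}

/-- The derived system `K'`: the span at `x` of the values `θ_x` of the (local) sections `θ` of `K`
with `dθ ≡ 0 mod K`. -/
def derivedSystem (K : CotangentSystem I M) : CotangentSystem I M := fun x ↦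
  Submodule.span ℝ {α : Cotangent I x | ∃ (U : Set M) (θ : OneForm I M), IsOpen U ∧ x ∈ U ∧
    SmoothFormOn θ U ∧ (∀ y ∈ U, θ y ∈ K y ∧ ModEq K y (dForm θ y) (fun _ _ ↦ 0)) ∧ α = θ x}

/-- On the open set `U`, the forms `θ¹, …, θˢ, ω₁, π₁, ω₂, π₂` are a smooth coframe such that
`K = span {θ¹, …, θˢ}` and, modulo `K`,
`dθⁱ ≡ 0` for `1 ≤ i ≤ s - 2`, `dθˢ⁻¹ ≡ ω₁ ∧ π₁`, `dθˢ ≡ ω₂ ∧ π₂`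
(in the code the index `i : Fin s` starts from `0`). -/
structure IsHyperbolicCoframe (K : CotangentSystem I M) {s : ℕ} (U : Set M)
    (θ : Fin s → OneForm I M) (ω₁ π₁ ω₂ π₂ : OneForm I M) : Prop where
  smooth_θ : ∀ i, SmoothFormOn (θ i) U
  smooth_ω₁ : SmoothFormOn ω₁ U
  smooth_π₁ : SmoothFormOn π₁ U
  smooth_ω₂ : SmoothFormOn ω₂ U
  smooth_π₂ : SmoothFormOn π₂ U
  linearIndependent : ∀ y ∈ U, LinearIndependent ℝ
    (Sum.elim (fun i ↦ θ i y) ![ω₁ y, π₁ y, ω₂ y, π₂ y] : Fin s ⊕ Fin 4 → Cotangent I y)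
  span_eq_top : ∀ y ∈ U, Submodule.span ℝ (Set.range
    (Sum.elim (fun i ↦ θ i y) ![ω₁ y, π₁ y, ω₂ y, π₂ y] : Fin s ⊕ Fin 4 → Cotangent I y)) = ⊤
  eq_span : ∀ y ∈ U, K y = Submodule.span ℝ (Set.range fun i ↦ θ i y)
  d_zero : ∀ y ∈ U, ∀ i : Fin s, (i : ℕ) + 2 < s → ModEq K y (dForm (θ i) y) (fun _ _ ↦ 0)
  d_fst : ∀ y ∈ U, ∀ i : Fin s, (i : ℕ) + 2 = s →
    ModEq K y (dForm (θ i) y) (wedge (ω₁ y) (π₁ y))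
  d_snd : ∀ y ∈ U, ∀ i : Fin s, (i : ℕ) + 1 = s →
    ModEq K y (dForm (θ i) y) (wedge (ω₂ y) (π₂ y))

/-- `K` is a hyperbolic Pfaffian system of class `s` with associated characteristic (singular)
systems `V₁` and `V₂`: about each point there is a coframe as in `IsHyperbolicCoframe` with
`V₁ = span {θⁱ, π₁, ω₁}` and `V₂ = span {θⁱ, π₂, ω₂}`. -/
def IsHyperbolic (K : CotangentSystem I M) (s : ℕ) (V₁ V₂ : CotangentSystem I M) : Prop :=
  2 ≤ s ∧ ∀ x : M, ∃ U : Set M, IsOpen U ∧ x ∈ U ∧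
    ∃ (θ : Fin s → OneForm I M) (ω₁ π₁ ω₂ π₂ : OneForm I M),
      IsHyperbolicCoframe K U θ ω₁ π₁ ω₂ π₂ ∧
      ∀ y ∈ U,
        V₁ y = Submodule.span ℝ (Set.range (fun i ↦ θ i y) ∪ {π₁ y, ω₁ y}) ∧
        V₂ y = Submodule.span ℝ (Set.range (fun i ↦ θ i y) ∪ {π₂ y, ω₂ y})

/-- The hyperbolic system `K` with singular systems `V₁`, `V₂` is Darboux integrable:
`K^∞ = 0`, `V₁ + V₂^∞ = T*M` and `V₁^∞ + V₂ = T*M`. -/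
structure IsDarbouxIntegrable (K V₁ V₂ : CotangentSystem I M) : Prop where
  firstIntegrals_eq_bot : ∀ x, firstIntegrals K x = ⊥
  sup_firstIntegrals_eq_top : ∀ x, V₁ x ⊔ firstIntegrals V₂ x = ⊤
  firstIntegrals_sup_eq_top : ∀ x, firstIntegrals V₁ x ⊔ V₂ x = ⊤

end Forms

section Maps

variable {E : Type*} [NormedAddCommGroup E] [NormedSpace ℝ E]
  {H : Type*} [TopologicalSpace H] {I : ModelWithCorners ℝ E H}
  {M : Type*} [TopologicalSpace M] [ChartedSpace H M]
  {E' : Type*} [NormedAddCommGroup E'] [NormedSpace ℝ E']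
  {H' : Type*} [TopologicalSpace H'] {I' : ModelWithCorners ℝ E' H'}
  {M' : Type*} [TopologicalSpace M'] [ChartedSpace H' M']

variable (I I') in
/-- The pullback `f^* α = α ∘ f_*` to `T*_x M` of a covector `α` at `f x`. -/
def pullbackCovector (f : M → M') (x : M) : Cotangent I' (f x) →ₗ[ℝ] Cotangent I x where
  toFun α := α.comp (mfderiv I I' f x)
  map_add' _ _ := ContinuousLinearMap.add_comp _ _ _
  map_smul' _ _ := ContinuousLinearMap.smul_comp _ _ _

variable (I) in
/-- The pullback `f^* K`, whose fibre at `x` consists of the pullbacks of the covectors in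
`K` at `f x`. -/
def pullbackSystem (f : M → M') (K : CotangentSystem I' M') : CotangentSystem I M := fun x ↦
  (K (f x)).map (pullbackCovector I I' f x)

/-- The sum `K₁ + K₂ = π₁^* K₁ + π₂^* K₂` on the product `M × M'`. -/
def sumSystem (K₁ : CotangentSystem I M) (K₂ : CotangentSystem I' M') :
    CotangentSystem (I.prod I') (M × M') := fun p ↦
  pullbackSystem (I.prod I') Prod.fst K₁ p ⊔ pullbackSystem (I.prod I') Prod.snd K₂ p

/-- The reduction of `K` along a quotient map `q : M → M' = M / G`: the covectors on `M / G` whose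
pullback by `q` (to every point of the fibre) lies in `K`. -/
def reducedSystem (q : M → M') (K : CotangentSystem I M) : CotangentSystem I' M' := fun y ↦
  { carrier := {α | ∀ (x : M) (h : q x = y), pullbackCovector I I' q x (h ▸ α) ∈ K x}
    zero_mem' := by
      rintro x rfl
      rw [map_zero]
      exact (K x).zero_mem
    add_mem' := by
      rintro α β hα hβ x rfl
      rw [map_add]
      exact (K x).add_mem (hα x rfl) (hβ x rfl)
    smul_mem' := by
      rintro c α hα x rfl
      rw [map_smul]
      exact (K x).smul_mem c (hα x rfl) }

variable (I I') in
/-- `s`, restricted to the open set `U`, is an integral manifold of `K`: a smooth immersion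
with `s^* K = 0`. -/
structure IsIntegralManifoldOn (K : CotangentSystem I' M') (s : M → M') (U : Set M) : Prop where
  smooth : ContMDiffOn I I' ∞ s U
  immersion : ∀ x ∈ U, Function.Injective (mfderiv I I' s x)
  pullback_eq_zero : ∀ x ∈ U, ∀ α ∈ K (s x), pullbackCovector I I' s x α = 0

variable (I I') in
/-- `q : M → M'` exhibits the manifold `M'` as the quotient of `M` by the action of `G`, and
this action is regular: `q` is a smooth surjective submersion whose fibres are the `G`-orbits. -/
structure IsSmoothQuotient (G : Type*) [Group G] [MulAction G M] (q : M → M') : Prop where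
  smooth : ContMDiff I I' ∞ q
  surjective : Function.Surjective q
  submersion : ∀ x, Function.Surjective (mfderiv I I' q x)
  fibre : ∀ x y, q x = q y ↔ ∃ g : G, g • x = y

variable (I') in
/-- The group acting, with quotient map `q`, acts transversally to `K`:
`ker (q_*) ∩ ann(K) = 0`. -/
def ActsTransversally (q : M → M') (K : CotangentSystem I M) : Prop :=
  ∀ x, ∀ v ∈ ann K x, mfderiv I I' q x v = 0 → v = 0

/-- `G` is a symmetry group of `K`: `g^* K = K` for all `g ∈ G`. -/
def IsSymmetryGroup (G : Type*) [Group G] [MulAction G M] (K : CotangentSystem I M) : Prop :=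
  ∀ g : G, pullbackSystem I (fun x : M ↦ g • x) K = K

/-- The action of `G` on `X` is free. -/
def ActsFreely (G X : Type*) [Group G] [MulAction G X] : Prop :=
  ∀ (g : G) (x : X), g • x = x → g = 1

end Maps

section Curves

variable {E : Type*} [NormedAddCommGroup E] [NormedSpace ℝ E]
  {H : Type*} [TopologicalSpace H] (I : ModelWithCorners ℝ E H)
  {M : Type*} [TopologicalSpace M] [ChartedSpace H M]

/-- The open interval `(a, b) ⊆ ℝ`, possibly unbounded. -/
def openInterval (a b : EReal) : Set ℝ := {t : ℝ | a < (t : EReal) ∧ (t : EReal) < b}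

/-- The velocity vector of a curve. -/
def velocity (γ : ℝ → M) (t : ℝ) : TangentSpace I (γ t) :=
  mfderiv 𝓘(ℝ, ℝ) I γ t (1 : ℝ)

/-- `γ`, restricted to the open interval `J`, is a non-characteristic integral curve of the
hyperbolic system `K` with singular systems `V₁`, `V₂`. -/
structure IsNonCharacteristicCurveOn (K V₁ V₂ : CotangentSystem I M) (γ : ℝ → M) (J : Set ℝ) :
    Prop where
  integral : IsIntegralManifoldOn 𝓘(ℝ, ℝ) I K γ J
  not_mem_ann_fst : ∀ t ∈ J, velocity I γ t ∉ ann V₁ (γ t)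
  not_mem_ann_snd : ∀ t ∈ J, velocity I γ t ∉ ann V₂ (γ t)

/-- `s : N → M`, with `N ⊆ ℝ²` open, solves the Cauchy problem for the integral curve
`γ : J → M` of `K`: it is a two-dimensional integral manifold of `K` and `γ(J) ⊆ s(N)`. -/
structure SolvesCauchyProblem (K : CotangentSystem I M) (γ : ℝ → M) (J : Set ℝ)
    (s : ℝ × ℝ → M) (N : Set (ℝ × ℝ)) : Prop where
  integral : IsIntegralManifoldOn (𝓘(ℝ, ℝ).prod 𝓘(ℝ, ℝ)) I K s N
  subset : γ '' J ⊆ s '' N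

end Curves

section QuotientRepresentation

variable {E₁ : Type*} [NormedAddCommGroup E₁] [NormedSpace ℝ E₁]
  {M₁ : Type*} [TopologicalSpace M₁] [ChartedSpace E₁ M₁]
  {E₂ : Type*} [NormedAddCommGroup E₂] [NormedSpace ℝ E₂]
  {M₂ : Type*} [TopologicalSpace M₂] [ChartedSpace E₂ M₂]
  (F₁ : Type*) [NormedAddCommGroup F₁] [NormedSpace ℝ F₁]
  {B₁ : Type*} [TopologicalSpace B₁] [ChartedSpace F₁ B₁]
  (F₂ : Type*) [NormedAddCommGroup F₂] [NormedSpace ℝ F₂]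
  {B₂ : Type*} [TopologicalSpace B₂] [ChartedSpace F₂ B₂]
  {E : Type*} [NormedAddCommGroup E] [NormedSpace ℝ E]
  {M : Type*} [TopologicalSpace M] [ChartedSpace E M]

/-- The canonical quotient representation `K = (K₁ + K₂) / G_diag` on
`M = (M₁ × M₂) / G_diag`. Here `q₁ : M₁ → B₁`, `q₂ : M₂ → B₂` and `q : M₁ × M₂ → M` are the
quotient maps by `G` (acting diagonally on `M₁ × M₂`). -/
structure IsCanonicalQuotientRepresentation (G : Type*) [Group G] [MulAction G M₁] [MulAction G M₂]
    (K₁ : CotangentSystem 𝓘(ℝ, E₁) M₁) (K₂ : CotangentSystem 𝓘(ℝ, E₂) M₂)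
    (q₁ : M₁ → B₁) (q₂ : M₂ → B₂) (q : M₁ × M₂ → M) (K : CotangentSystem 𝓘(ℝ, E) M) : Prop where
  /-- `K₁` and `K₂` are constant rank Pfaffian systems of codimension two. -/
  codim_fst : ∃ r : ℕ, r + 2 = Module.finrank ℝ E₁ ∧ IsPfaffianOfRank K₁ r
  codim_snd : ∃ r : ℕ, r + 2 = Module.finrank ℝ E₂ ∧ IsPfaffianOfRank K₂ r
  /-- They have no non-trivial first integrals. -/
  firstIntegrals_fst : ∀ x, firstIntegrals K₁ x = ⊥
  firstIntegrals_snd : ∀ x, firstIntegrals K₂ x = ⊥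
  /-- `G` acts freely and regularly on `M₁` and on `M₂`. -/
  free_fst : ActsFreely G M₁
  free_snd : ActsFreely G M₂
  regular_fst : IsSmoothQuotient 𝓘(ℝ, E₁) 𝓘(ℝ, F₁) G q₁
  regular_snd : IsSmoothQuotient 𝓘(ℝ, E₂) 𝓘(ℝ, F₂) G q₂
  /-- `G` is a common symmetry group of `K₁` and `K₂`. -/
  symmetry_fst : IsSymmetryGroup G K₁
  symmetry_snd : IsSymmetryGroup G K₂
  /-- `G` acts transversally to `K₁` and to `K₂`. -/
  transverse_fst : ActsTransversally 𝓘(ℝ, F₁) q₁ K₁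
  transverse_snd : ActsTransversally 𝓘(ℝ, F₂) q₂ K₂
  /-- `G_diag` acts regularly on `M₁ × M₂` with quotient `M`, and transversally to
  `K₁' + K₂'`. -/
  regular_diag : IsSmoothQuotient (𝓘(ℝ, E₁).prod 𝓘(ℝ, E₂)) 𝓘(ℝ, E) G q
  transverse_diag : ActsTransversally 𝓘(ℝ, E) q (sumSystem (derivedSystem K₁) (derivedSystem K₂))
  /-- `K` is the quotient `(K₁ + K₂) / G_diag`. -/
  eq_reduced : K = reducedSystem q (sumSystem K₁ K₂)

end QuotientRepresentation

end Pfaff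

end

open Pfaff

/-! ### Exterior derivatives along surfaces -/

namespace Pfaff

/-! Write `D` for the differential of `q`. The tangent vectors of the surface are `D (x • σ₁', y •
σ₂')` with `σᵢ'` in `ann Kᵢ`, so every covector of the reduced system kills them; the diagonal
points `(t, t)` recover `γ`. The real content is the immersion property. Transversality makes `D`
injective on `ann K₁ × ann K₂`, so it remains to see that neither `σ₁'` nor `σ₂'` ever vanishes.

If, say, `σ₁' = 0`, then `γ' = D (0, σ₂')`, so it suffices that `D` maps each factor `ann Kᵢ` into
the annihilator of one of the two singular systems (`IsHyperbolic.mfderiv_factor_mem_ann`): this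
contradicts `γ` being non-characteristic.

Two facts give this inclusion. First, `dθ (D (u, 0), D (0, v)) = 0` for every section `θ` of the
reduced system (`dForm_reducedSystem_eq_zero`), by computing on the surface swept out by a curve in
each factor. By the structure equations, both `ω₁ ∧ π₁` and `ω₂ ∧ π₂` then pair the images of the
two factors to zero. Second, `(ω₁, π₁, ω₂, π₂)` identifies `ann K₁ × ann K₂` with `ℝ⁴`, and there
such orthogonality forces each factor to be killed by one of the pairs `(ω₁, π₁)`, `(ω₂, π₂)`
(`vanish_of_orthogonal_of_surjective`). -/

theorem extDeriv_ofSubsingleton_apply {E : Type*} [NormedAddCommGroup E] [NormedSpace ℝ E]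
    {Θ : E → E →L[ℝ] ℝ} {x : E} (hΘ : DifferentiableAt ℝ Θ x) (u v : E) :
    extDeriv (fun y : E ↦ ContinuousAlternatingMap.ofSubsingleton ℝ E ℝ (0 : Fin 1) (Θ y)) x ![u, v]
      = fderiv ℝ Θ x u v - fderiv ℝ Θ x v u := by
  have h := (ContinuousAlternatingMap.ofSubsingletonLIE (𝕜 := ℝ) (E := E) (F := ℝ)
    (0 : Fin 1)).toContinuousLinearEquiv.toContinuousLinearMap.hasFDerivAt.comp x hΘ.hasFDerivAt
  have h' : fderiv ℝ
      (fun y : E ↦ ContinuousAlternatingMap.ofSubsingleton ℝ E ℝ (0 : Fin 1) (Θ y)) x = _ :=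
    h.fderiv
  rw [extDeriv, ContinuousAlternatingMap.alternatizeUncurryFin_apply, h']
  simp [Fin.sum_univ_succ, Fin.removeNth, sub_eq_add_neg]

/-- Differentiating each hypothesis along its line gives a derivative of `Θ` plus `Θ` applied to a
second derivative of `Q`. The second derivative is symmetric, so these terms cancel in the
difference. This is `d(Q^*Θ) = Q^* dΘ` for a pullback known only on two lines. -/
theorem fderiv_symm_of_apply_fderiv_eq_zero {F E : Type*} [NormedAddCommGroup F] [NormedSpace ℝ F]
    [NormedAddCommGroup E] [NormedSpace ℝ E] {Q : F → E} {Θ : E → E →L[ℝ] ℝ} {z u v : F}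
    (hQ : ContDiffAt ℝ 2 Q z) (hΘ : DifferentiableAt ℝ Θ (Q z))
    (hu : ∀ᶠ τ in 𝓝 (0 : ℝ), Θ (Q (z + τ • v)) (fderiv ℝ Q (z + τ • v) u) = 0)
    (hv : ∀ᶠ τ in 𝓝 (0 : ℝ), Θ (Q (z + τ • u)) (fderiv ℝ Q (z + τ • u) v) = 0) :
    fderiv ℝ Θ (Q z) (fderiv ℝ Q z u) (fderiv ℝ Q z v) =
      fderiv ℝ Θ (Q z) (fderiv ℝ Q z v) (fderiv ℝ Q z u) := by
  have hQ1 : HasFDerivAt Q (fderiv ℝ Q z) z := (hQ.differentiableAt (by norm_num)).hasFDerivAt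
  have hQ2 : HasFDerivAt (fderiv ℝ Q) (fderiv ℝ (fderiv ℝ Q) z) z :=
    ((hQ.fderiv_right (m := 1) (by norm_num)).differentiableAt (by norm_num)).hasFDerivAt
  have hsymm : IsSymmSndFDerivAt ℝ Q z := hQ.isSymmSndFDerivAt (by simp)
  have key : ∀ u v : F, (∀ᶠ τ in 𝓝 (0 : ℝ), Θ (Q (z + τ • v)) (fderiv ℝ Q (z + τ • v) u) = 0) →
      fderiv ℝ Θ (Q z) (fderiv ℝ Q z v) (fderiv ℝ Q z u) +
        Θ (Q z) (fderiv ℝ (fderiv ℝ Q) z v u) = 0 := by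
    intro u v hu
    have hl : HasDerivAt (fun τ : ℝ ↦ z + τ • v) v 0 := by
      simpa using ((hasDerivAt_id (0 : ℝ)).smul_const v).const_add z
    have h0 : z + (0 : ℝ) • v = z := by simp
    have h1 : HasDerivAt (fun τ : ℝ ↦ Q (z + τ • v)) (fderiv ℝ Q z v) 0 :=
      HasFDerivAt.comp_hasDerivAt (f := fun τ : ℝ ↦ z + τ • v) 0 (by rwa [h0]) hl
    have h2 : HasDerivAt (fun τ : ℝ ↦ Θ (Q (z + τ • v))) (fderiv ℝ Θ (Q z) (fderiv ℝ Q z v)) 0 :=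
      HasFDerivAt.comp_hasDerivAt (f := fun τ : ℝ ↦ Q (z + τ • v)) 0
        (by simpa only [h0] using hΘ.hasFDerivAt) h1
    have h3 : HasDerivAt (fun τ : ℝ ↦ fderiv ℝ Q (z + τ • v)) (fderiv ℝ (fderiv ℝ Q) z v) 0 :=
      HasFDerivAt.comp_hasDerivAt (f := fun τ : ℝ ↦ z + τ • v) 0 (by rwa [h0]) hl
    have h4 := h2.clm_apply (h3.clm_apply (hasDerivAt_const (0 : ℝ) u))
    simp only [h0, map_zero, add_zero] at h4
    exact h4.unique ((hasDerivAt_const (0 : ℝ) (0 : ℝ)).congr_of_eventuallyEq hu)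
  have e1 := key u v hu
  have e2 := key v u hv
  rw [hsymm.eq v u] at e1
  linarith

section FormAlongSurface

variable {E : Type*} [NormedAddCommGroup E] [NormedSpace ℝ E]
  {M : Type*} [TopologicalSpace M] [ChartedSpace E M]

theorem mfderiv_prod_self_eq_fderiv (Q : ℝ × ℝ → E) (z : ℝ × ℝ) :
    mfderiv (𝓘(ℝ, ℝ).prod 𝓘(ℝ, ℝ)) 𝓘(ℝ, E) Q z = fderiv ℝ Q z := by
  rw [← modelWithCornersSelf_prod, chartedSpaceSelf_prod, mfderiv_eq_fderiv]

variable [IsManifold 𝓘(ℝ, E) ∞ M]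

theorem coordForm_apply_mfderiv_extChartAt (θ : OneForm 𝓘(ℝ, E) M) (x : M) {y : M}
    (hy : y ∈ (extChartAt 𝓘(ℝ, E) x).source) (v : TangentSpace 𝓘(ℝ, E) y) :
    coordForm θ x (extChartAt 𝓘(ℝ, E) x y) (mfderiv 𝓘(ℝ, E) 𝓘(ℝ, E) (extChartAt 𝓘(ℝ, E) x) y v) =
      θ y v := by
  have : IsManifold 𝓘(ℝ, E) 1 M := IsManifold.of_le (n := ∞) (by simp)
  have h := mfderivWithin_extChartAt_symm_comp_mfderiv_extChartAt' (I := 𝓘(ℝ, E)) hy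
  have hr : Set.range (𝓘(ℝ, E)) = Set.univ := by simp
  rw [hr, mfderivWithin_univ] at h
  have h2 := DFunLike.congr_fun h v
  have hl := (extChartAt 𝓘(ℝ, E) x).left_inv hy
  unfold coordForm
  -- The type of `θ y'` depends on the base point, so the equality of points is generalised and
  -- eliminated by substitution.
  have aux : ∀ (y' : M) (hyy : y' = y) (w : E), w = v → θ y' w = θ y v := by
    rintro y' rfl w rfl; rfl
  exact aux _ hl _ h2

/-- The vector space computation, read in the chart at `S z`. The form need not vanish on the whole
surface: each direction is tested only along the line through `z` in the other direction. -/
theorem dForm_eq_zero_of_surface {S : ℝ × ℝ → M} {z : ℝ × ℝ}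
    (hS : ContMDiffAt (𝓘(ℝ, ℝ).prod 𝓘(ℝ, ℝ)) 𝓘(ℝ, E) ∞ S z) {θ : OneForm 𝓘(ℝ, E) M}
    (hθ : ContDiffAt ℝ ∞ (coordForm θ (S z)) (extChartAt 𝓘(ℝ, E) (S z) (S z)))
    (u v : ℝ × ℝ)
    (hu : ∀ᶠ τ in 𝓝 (0 : ℝ), θ (S (z + τ • v))
      (mfderiv (𝓘(ℝ, ℝ).prod 𝓘(ℝ, ℝ)) 𝓘(ℝ, E) S (z + τ • v) u) = 0)
    (hv : ∀ᶠ τ in 𝓝 (0 : ℝ), θ (S (z + τ • u))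
      (mfderiv (𝓘(ℝ, ℝ).prod 𝓘(ℝ, ℝ)) 𝓘(ℝ, E) S (z + τ • u) v) = 0) :
    dForm θ (S z) (mfderiv (𝓘(ℝ, ℝ).prod 𝓘(ℝ, ℝ)) 𝓘(ℝ, E) S z u)
      (mfderiv (𝓘(ℝ, ℝ).prod 𝓘(ℝ, ℝ)) 𝓘(ℝ, E) S z v) = 0 := by
  have : IsManifold 𝓘(ℝ, E) 1 M := IsManifold.of_le (n := ∞) (by simp)
  set φ := extChartAt 𝓘(ℝ, E) (S z) with hφ
  set Q : ℝ × ℝ → E := fun w ↦ φ (S w) with hQdef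
  have hQm : ContMDiffAt (𝓘(ℝ, ℝ).prod 𝓘(ℝ, ℝ)) 𝓘(ℝ, E) ∞ Q z :=
    ContMDiffAt.comp z contMDiffAt_extChartAt hS
  have hQ : ContDiffAt ℝ 2 Q z := by
    rw [← modelWithCornersSelf_prod, chartedSpaceSelf_prod] at hQm
    exact contDiffAt_infty.1 hQm.contDiffAt 2
  have hS1 : ∀ᶠ w in 𝓝 z, MDifferentiableAt (𝓘(ℝ, ℝ).prod 𝓘(ℝ, ℝ)) 𝓘(ℝ, E) S w := by
    have := (contMDiffAt_iff_contMDiffAt_nhds (n := 1) (by simp)).1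
      (hS.of_le (by exact_mod_cast le_top))
    exact this.mono fun w hw ↦ hw.mdifferentiableAt one_ne_zero
  have hsrc : ∀ᶠ w in 𝓝 z, S w ∈ φ.source :=
    hS.continuousAt.eventually (extChartAt_source_mem_nhds (I := 𝓘(ℝ, E)) (S z))
  have hder : ∀ᶠ w in 𝓝 z, ∀ a : ℝ × ℝ,
      fderiv ℝ Q w a = mfderiv 𝓘(ℝ, E) 𝓘(ℝ, E) φ (S w)
        (mfderiv (𝓘(ℝ, ℝ).prod 𝓘(ℝ, ℝ)) 𝓘(ℝ, E) S w a) := by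
    filter_upwards [hS1, hsrc] with w hw hw' a
    have := mfderiv_comp w (mdifferentiableAt_extChartAt (I := 𝓘(ℝ, E)) (x := S z)
      (by simpa [hφ] using hw')) hw
    rw [← mfderiv_prod_self_eq_fderiv]
    exact DFunLike.congr_fun this a
  have hline : ∀ a : ℝ × ℝ, Filter.Tendsto (fun τ : ℝ ↦ z + τ • a) (𝓝 0) (𝓝 z) := fun a ↦ by
    have : Continuous fun τ : ℝ ↦ z + τ • a := by fun_prop
    simpa using this.tendsto 0
  have hform : ∀ᶠ w in 𝓝 z, ∀ a : ℝ × ℝ, coordForm θ (S z) (Q w) (fderiv ℝ Q w a) =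
      θ (S w) (mfderiv (𝓘(ℝ, ℝ).prod 𝓘(ℝ, ℝ)) 𝓘(ℝ, E) S w a) := by
    filter_upwards [hder, hsrc] with w hw hw' a
    rw [hw a]
    exact coordForm_apply_mfderiv_extChartAt θ (S z) hw' _
  have hΘ : DifferentiableAt ℝ (coordForm θ (S z)) (Q z) := hθ.differentiableAt (by simp)
  have hself : ∀ a : ℝ × ℝ, fderiv ℝ Q z a =
      (mfderiv (𝓘(ℝ, ℝ).prod 𝓘(ℝ, ℝ)) 𝓘(ℝ, E) S z a : E) := fun a ↦ by
    -- At its own centre the preferred chart has identity differential, matching the convention of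
    -- `dForm`.
    rw [hder.self_of_nhds a, hφ, mfderiv_extChartAt_self]
    rfl
  have key := fderiv_symm_of_apply_fderiv_eq_zero (u := u) (v := v) hQ hΘ
    (by filter_upwards [hu, (hline v).eventually hform] with τ h1 h2; rw [h2, h1])
    (by filter_upwards [hv, (hline u).eventually hform] with τ h1 h2; rw [h2, h1])
  unfold dForm
  rw [hself, hself] at key
  exact (extDeriv_ofSubsingleton_apply hΘ _ _).trans (sub_eq_zero.2 key)

/-- A straight line in the chart, carried back to the manifold. -/
theorem exists_curve_velocity (x : M) (u : E) : ∃ c : ℝ → M,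
    ContMDiffAt 𝓘(ℝ, ℝ) 𝓘(ℝ, E) ∞ c 0 ∧ c 0 = x ∧ (velocity 𝓘(ℝ, E) c 0 : E) = u := by
  have : IsManifold 𝓘(ℝ, E) 1 M := IsManifold.of_le (n := ∞) (by simp)
  set φ := extChartAt 𝓘(ℝ, E) x with hφ
  have hl : HasDerivAt (fun τ : ℝ ↦ φ x + τ • u) u 0 := by
    simpa using ((hasDerivAt_id (0 : ℝ)).smul_const u).const_add (φ x)
  have hlm : ContMDiff 𝓘(ℝ, ℝ) 𝓘(ℝ, E) ∞ (fun τ : ℝ ↦ φ x + τ • u) := by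
    rw [contMDiff_iff_contDiff]; fun_prop
  have h0 : φ x + (0 : ℝ) • u = φ x := by simp
  have hsymm : ContMDiffAt 𝓘(ℝ, E) 𝓘(ℝ, E) ∞ φ.symm (φ x) :=
    (contMDiffOn_extChartAt_symm x).contMDiffAt (extChartAt_target_mem_nhds x)
  refine ⟨fun τ ↦ φ.symm (φ x + τ • u), ?_, ?_, ?_⟩
  · exact ContMDiffAt.comp (f := fun τ : ℝ ↦ φ x + τ • u) 0 (by rwa [h0]) (hlm 0)
  · simp [hφ]
  · have hr : Set.range (𝓘(ℝ, E)) = Set.univ := by simp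
    have hid := mfderivWithin_range_extChartAt_symm (I := 𝓘(ℝ, E)) (x := x)
    rw [hr, mfderivWithin_univ] at hid
    have hd : MDifferentiableAt 𝓘(ℝ, E) 𝓘(ℝ, E) φ.symm (φ x + (0 : ℝ) • u) := by
      rw [h0]; exact hsymm.mdifferentiableAt (by simp)
    have hc := mfderiv_comp (0 : ℝ) (f := fun τ : ℝ ↦ φ x + τ • u) hd
      ((hlm 0).mdifferentiableAt (by simp))
    have hc' := DFunLike.congr_fun hc (1 : ℝ)
    have hf : mfderiv 𝓘(ℝ, ℝ) 𝓘(ℝ, E) (fun τ : ℝ ↦ φ x + τ • u) 0 (1 : ℝ) = u := by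
      have h1 : fderiv ℝ (fun τ : ℝ ↦ φ x + τ • u) 0 1 = u := by
        rw [fderiv_apply_one_eq_deriv, hl.deriv]
      rw [mfderiv_eq_fderiv]
      exact h1
    refine hc'.trans ?_
    have aux : ∀ y, y = φ x → ∀ w : E, w = u →
        (mfderiv 𝓘(ℝ, E) 𝓘(ℝ, E) φ.symm y w : E) = u := by
      rintro y rfl w rfl
      exact DFunLike.congr_fun hid w
    exact aux _ h0 _ hf

end FormAlongSurface

end Pfaff

/-! ### Linear algebra of two complementary planes in `ℝ⁴` -/

namespace Pfaff

/-- For each coordinate pair, either its area form is zero on `P'`, and then orthogonality to `P`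
and surjectivity make both coordinates vanish on `P'`; or it is nonzero there, and then both
coordinates vanish on `P`. The second case cannot hold for both pairs, since `L` would kill `P`. -/
theorem vanish_of_orthogonal_of_surjective {P P' : Type*} [AddCommGroup P] [Module ℝ P]
    [AddCommGroup P'] [Module ℝ P'] [Nontrivial P] (L : P × P' →ₗ[ℝ] (Fin 4 → ℝ))
    (hinj : Function.Injective L) (hsurj : Function.Surjective L)
    (h₁ : ∀ x y, L (x, 0) 0 * L (0, y) 1 - L (0, y) 0 * L (x, 0) 1 = 0)
    (h₂ : ∀ x y, L (x, 0) 2 * L (0, y) 3 - L (0, y) 2 * L (x, 0) 3 = 0) :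
    (∀ y, L (0, y) 0 = 0 ∧ L (0, y) 1 = 0) ∨ (∀ y, L (0, y) 2 = 0 ∧ L (0, y) 3 = 0) := by
  have hadd : ∀ x y i, L (x, y) i = L (x, 0) i + L (0, y) i := fun x y i ↦ by
    rw [← Pi.add_apply, ← map_add]; simp
  have aux : ∀ i j : Fin 4, i ≠ j →
      (∀ x y, L (x, 0) i * L (0, y) j - L (0, y) i * L (x, 0) j = 0) →
      (∀ y, L (0, y) i = 0 ∧ L (0, y) j = 0) ∨ ∀ x, L (x, 0) i = 0 ∧ L (x, 0) j = 0 := by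
    intro i j hij h
    by_cases hB : ∀ y y', L (0, y) i * L (0, y') j - L (0, y') i * L (0, y) j = 0
    · left
      intro y
      have hall : ∀ p, L p i * L (0, y) j - L (0, y) i * L p j = 0 := fun p ↦ by
        rw [← Prod.mk.eta (p := p), hadd p.1 p.2 i, hadd p.1 p.2 j]
        linear_combination h p.1 y + hB p.2 y
      -- Testing against vectors with coordinates `(1, 0)` and `(0, 1)` in the pair `(i, j)`
      -- isolates each coordinate of `(0, y)`.
      obtain ⟨p, hp⟩ := hsurj (Pi.single i 1)
      obtain ⟨p', hp'⟩ := hsurj (Pi.single j 1)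
      have e := hall p
      have e' := hall p'
      rw [hp] at e
      rw [hp'] at e'
      simp only [Pi.single_eq_same, Pi.single_eq_of_ne hij, Pi.single_eq_of_ne hij.symm] at e e'
      constructor <;> linarith
    · right
      push Not at hB
      obtain ⟨y, y', hB⟩ := hB
      intro x
      constructor
      -- Cramer's rule: `h x y` and `h x y'` form a homogeneous linear system for the two
      -- coordinates of `(x, 0)`, with nonzero determinant `hB`.
      · refine (mul_eq_zero.1 ?_).resolve_right hB
        linear_combination L (0, y) i * h x y' - L (0, y') i * h x y
      · refine (mul_eq_zero.1 ?_).resolve_right hB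
        linear_combination L (0, y) j * h x y' - L (0, y') j * h x y
  rcases aux 0 1 (by decide) h₁ with h | h
  · exact .inl h
  rcases aux 2 3 (by decide) h₂ with h' | h'
  · exact .inr h'
  obtain ⟨x, hx⟩ := exists_ne (0 : P)
  refine absurd (congrArg Prod.fst (hinj (a₁ := (x, 0)) (a₂ := 0) ?_)) hx
  rw [map_zero]
  ext i
  fin_cases i
  exacts [(h x).1, (h x).2, (h' x).1, (h' x).2]

theorem vanish_on_snd_of_coframe {E₁ E₂ E : Type*} [AddCommGroup E₁] [Module ℝ E₁]
    [FiniteDimensional ℝ E₁] [AddCommGroup E₂] [Module ℝ E₂] [FiniteDimensional ℝ E₂]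
    [NormedAddCommGroup E] [NormedSpace ℝ E] (D : E₁ × E₂ →ₗ[ℝ] E) {P₁ : Submodule ℝ E₁}
    {P₂ : Submodule ℝ E₂} (hP₁ : 2 ≤ Module.finrank ℝ P₁) (hP₂ : 2 ≤ Module.finrank ℝ P₂)
    (hinj : ∀ u ∈ P₁, ∀ v ∈ P₂, D (u, v) = 0 → u = 0 ∧ v = 0) {ι : Type*} (θ : ι → E →L[ℝ] ℝ)
    (α : Fin 4 → E →L[ℝ] ℝ) (hspan : Submodule.span ℝ (Set.range (Sum.elim θ α)) = ⊤)
    (hθ : ∀ u ∈ P₁, ∀ v ∈ P₂, ∀ i, θ i (D (u, v)) = 0)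
    (h₁ : ∀ u ∈ P₁, ∀ v ∈ P₂,
      α 0 (D (u, 0)) * α 1 (D (0, v)) - α 0 (D (0, v)) * α 1 (D (u, 0)) = 0)
    (h₂ : ∀ u ∈ P₁, ∀ v ∈ P₂,
      α 2 (D (u, 0)) * α 3 (D (0, v)) - α 2 (D (0, v)) * α 3 (D (u, 0)) = 0) :
    (∀ v ∈ P₂, α 0 (D (0, v)) = 0 ∧ α 1 (D (0, v)) = 0) ∨
      (∀ v ∈ P₂, α 2 (D (0, v)) = 0 ∧ α 3 (D (0, v)) = 0) := by
  let L : P₁ × P₂ →ₗ[ℝ] (Fin 4 → ℝ) := LinearMap.pi fun i ↦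
    (α i : E →ₗ[ℝ] ℝ) ∘ₗ D ∘ₗ (P₁.subtype.prodMap P₂.subtype)
  have hL : ∀ w i, L w i = α i (D (w.1, w.2)) := fun _ _ ↦ rfl
  have hLinj : Function.Injective L := by
    rw [← LinearMap.ker_eq_bot, LinearMap.ker_eq_bot']
    intro w hw
    -- The `θ i` vanish on the image and the `α i` vanish by `hw`; together they span the dual,
    -- which separates points.
    have hall : ∀ β : E →L[ℝ] ℝ, β (D (w.1, w.2)) = 0 := by
      intro β
      have hβ : β ∈ Submodule.span ℝ (Set.range (Sum.elim θ α)) := hspan ▸ Submodule.mem_top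
      induction hβ using Submodule.span_induction with
      | mem β h =>
        obtain ⟨i | i, rfl⟩ := h
        · exact hθ _ w.1.2 _ w.2.2 i
        · exact congrFun hw i
      | zero => rfl
      | add β β' _ _ h h' => rw [add_apply, h, h', add_zero]
      | smul c β _ h => rw [smul_apply, h, smul_zero]
    have h0 := hinj _ w.1.2 _ w.2.2 ((SeparatingDual.eq_zero_iff_forall_dual_eq_zero (R := ℝ) _).2 hall)
    exact Prod.ext (Subtype.ext h0.1) (Subtype.ext h0.2)
  have hLsurj : Function.Surjective L := by
    refine (LinearMap.injective_iff_surjective_of_finrank_eq_finrank ?_).1 hLinj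
    -- Injectivity bounds the total dimension by 4, and the two factors contribute at least 2 each.
    have := LinearMap.finrank_le_finrank_of_injective hLinj
    rw [Module.finrank_prod, Module.finrank_fin_fun] at *
    omega
  have : Nontrivial P₁ := Module.nontrivial_of_finrank_pos (R := ℝ) (by omega)
  rcases vanish_of_orthogonal_of_surjective L hLinj hLsurj (fun x y ↦ h₁ _ x.2 _ y.2)
    (fun x y ↦ h₂ _ x.2 _ y.2) with h | h
  · exact .inl fun v hv ↦ h ⟨v, hv⟩
  · exact .inr fun v hv ↦ h ⟨v, hv⟩

/-! ### Annihilators of sums and quotients -/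

section Systems

variable {E₁ : Type*} [NormedAddCommGroup E₁] [NormedSpace ℝ E₁]
  {M₁ : Type*} [TopologicalSpace M₁] [ChartedSpace E₁ M₁]
  {E₂ : Type*} [NormedAddCommGroup E₂] [NormedSpace ℝ E₂]
  {M₂ : Type*} [TopologicalSpace M₂] [ChartedSpace E₂ M₂]
  {E : Type*} [NormedAddCommGroup E] [NormedSpace ℝ E]
  {M : Type*} [TopologicalSpace M] [ChartedSpace E M]
  {K₁ : CotangentSystem 𝓘(ℝ, E₁) M₁} {K₂ : CotangentSystem 𝓘(ℝ, E₂) M₂}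

theorem ann_span {x : M} (s : Set (Cotangent 𝓘(ℝ, E) x)) (K : CotangentSystem 𝓘(ℝ, E) M)
    (hK : K x = Submodule.span ℝ s) {v : TangentSpace 𝓘(ℝ, E) x} (hv : ∀ α ∈ s, α v = 0) :
    v ∈ ann K x := by
  intro α hα
  rw [hK] at hα
  induction hα using Submodule.span_induction with
  | mem α h => exact hv α h
  | zero => rfl
  | add α β _ _ h h' => rw [add_apply, h, h', add_zero]
  | smul c α _ h => rw [smul_apply, h, smul_zero]

/-- The common kernel of `r` covectors has codimension at most `r`. Only this inequality is needed.
-/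
theorem IsPfaffianOfRank.finrank_le_ann [FiniteDimensional ℝ E] {K : CotangentSystem 𝓘(ℝ, E) M}
    {r : ℕ} (hK : IsPfaffianOfRank K r) (x : M) :
    Module.finrank ℝ E ≤ Module.finrank ℝ (ann K x) + r := by
  obtain ⟨U, -, hxU, θ, -, hθ⟩ := hK x
  have hspan := (hθ x hxU).2
  have : FiniteDimensional ℝ (TangentSpace 𝓘(ℝ, E) x) := inferInstanceAs (FiniteDimensional ℝ E)
  let T : TangentSpace 𝓘(ℝ, E) x →ₗ[ℝ] (Fin r → ℝ) :=
    LinearMap.pi fun i ↦ (θ i x : TangentSpace 𝓘(ℝ, E) x →ₗ[ℝ] ℝ)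
  have hker : LinearMap.ker T ≤ ann K x := by
    intro v hv
    refine ann_span _ K hspan ?_
    rintro _ ⟨i, rfl⟩
    exact congrFun hv i
  have h1 := LinearMap.finrank_range_add_finrank_ker T
  have h2 := Submodule.finrank_mono hker
  have h3 := Submodule.finrank_le (LinearMap.range T)
  rw [Module.finrank_fin_fun] at h3
  have h4 : Module.finrank ℝ (TangentSpace 𝓘(ℝ, E) x) = Module.finrank ℝ E := rfl
  omega

theorem derivedSystem_le (K : CotangentSystem 𝓘(ℝ, E) M) (x : M) : derivedSystem K x ≤ K x := by
  refine Submodule.span_le.2 ?_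
  rintro _ ⟨U, θ, -, hx, -, h, rfl⟩
  exact (h x hx).1

theorem mem_ann_sumSystem {p : M₁ × M₂} {u : E₁} {v : E₂} :
    ((u, v) : E₁ × E₂) ∈ ann (sumSystem K₁ K₂) p ↔ u ∈ ann K₁ p.1 ∧ v ∈ ann K₂ p.2 := by
  have e₁ : ∀ α : Cotangent 𝓘(ℝ, E₁) p.1,
      pullbackCovector (𝓘(ℝ, E₁).prod 𝓘(ℝ, E₂)) 𝓘(ℝ, E₁) Prod.fst p α (u, v) = α u := by
    intro α
    simp only [pullbackCovector, mfderiv_fst]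
    rfl
  have e₂ : ∀ α : Cotangent 𝓘(ℝ, E₂) p.2,
      pullbackCovector (𝓘(ℝ, E₁).prod 𝓘(ℝ, E₂)) 𝓘(ℝ, E₂) Prod.snd p α (u, v) = α v := by
    intro α
    simp only [pullbackCovector, mfderiv_snd]
    rfl
  constructor
  · refine fun h ↦ ⟨fun α hα ↦ ?_, fun α hα ↦ ?_⟩
    · rw [← e₁ α]
      exact h _ (Submodule.mem_sup_left (Submodule.mem_map_of_mem hα))
    · rw [← e₂ α]
      exact h _ (Submodule.mem_sup_right (Submodule.mem_map_of_mem hα))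
  · rintro ⟨hu, hv⟩ β hβ
    obtain ⟨β₁, ⟨α₁, h₁, rfl⟩, β₂, ⟨α₂, h₂, rfl⟩, rfl⟩ := Submodule.mem_sup.1 hβ
    exact (congrArg₂ (· + ·) ((e₁ α₁).trans (hu _ h₁)) ((e₂ α₂).trans (hv _ h₂))).trans (add_zero 0)

theorem mfderiv_mem_ann_reducedSystem (q : M₁ × M₂ → M)
    (K : CotangentSystem (𝓘(ℝ, E₁).prod 𝓘(ℝ, E₂)) (M₁ × M₂)) {p : M₁ × M₂}
    {w : TangentSpace (𝓘(ℝ, E₁).prod 𝓘(ℝ, E₂)) p} (hw : w ∈ ann K p) :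
    mfderiv (𝓘(ℝ, E₁).prod 𝓘(ℝ, E₂)) 𝓘(ℝ, E) q p w ∈
      ann (reducedSystem (I' := 𝓘(ℝ, E)) q K) (q p) :=
  fun _ hα ↦ hw _ (hα p rfl)

theorem mfderiv_apply_eq_smul_velocity (c : ℝ → M) (t a : ℝ) :
    (mfderiv 𝓘(ℝ, ℝ) 𝓘(ℝ, E) c t a : E) = a • velocity 𝓘(ℝ, E) c t :=
  (congrArg (mfderiv 𝓘(ℝ, ℝ) 𝓘(ℝ, E) c t) (mul_one a).symm).trans
    ((mfderiv 𝓘(ℝ, ℝ) 𝓘(ℝ, E) c t).map_smul a (1 : ℝ))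

theorem mfderiv_mul_curves {q : M₁ × M₂ → M} {c₁ : ℝ → M₁} {c₂ : ℝ → M₂} {z : ℝ × ℝ}
    (hq : MDifferentiableAt (𝓘(ℝ, E₁).prod 𝓘(ℝ, E₂)) 𝓘(ℝ, E) q (c₁ z.1, c₂ z.2))
    (h₁ : MDifferentiableAt 𝓘(ℝ, ℝ) 𝓘(ℝ, E₁) c₁ z.1)
    (h₂ : MDifferentiableAt 𝓘(ℝ, ℝ) 𝓘(ℝ, E₂) c₂ z.2) (a b : ℝ) :
    (mfderiv (𝓘(ℝ, ℝ).prod 𝓘(ℝ, ℝ)) 𝓘(ℝ, E) (fun t : ℝ × ℝ ↦ q (c₁ t.1, c₂ t.2)) z (a, b) : E) =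
      mfderiv (𝓘(ℝ, E₁).prod 𝓘(ℝ, E₂)) 𝓘(ℝ, E) q (c₁ z.1, c₂ z.2)
        ((a • velocity 𝓘(ℝ, E₁) c₁ z.1 : E₁), (b • velocity 𝓘(ℝ, E₂) c₂ z.2 : E₂)) := by
  have hc := (HasMFDerivAt.comp z (g := q) (f := Prod.map c₁ c₂) hq.hasMFDerivAt
    (h₁.hasMFDerivAt.prodMap h₂.hasMFDerivAt)).mfderiv
  rw [← mfderiv_apply_eq_smul_velocity, ← mfderiv_apply_eq_smul_velocity]
  exact DFunLike.congr_fun hc ((a, b) : ℝ × ℝ)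

theorem contMDiffAt_mul_curves {q : M₁ × M₂ → M} {c₁ : ℝ → M₁} {c₂ : ℝ → M₂} {z : ℝ × ℝ}
    (hq : ContMDiff (𝓘(ℝ, E₁).prod 𝓘(ℝ, E₂)) 𝓘(ℝ, E) ∞ q)
    (h₁ : ContMDiffAt 𝓘(ℝ, ℝ) 𝓘(ℝ, E₁) ∞ c₁ z.1)
    (h₂ : ContMDiffAt 𝓘(ℝ, ℝ) 𝓘(ℝ, E₂) ∞ c₂ z.2) :
    ContMDiffAt (𝓘(ℝ, ℝ).prod 𝓘(ℝ, ℝ)) 𝓘(ℝ, E) ∞ (fun t : ℝ × ℝ ↦ q (c₁ t.1, c₂ t.2)) z :=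
  ContMDiffAt.comp z (hq.contMDiffAt (x := (c₁ z.1, c₂ z.2))) (h₁.prodMap h₂)

variable [IsManifold 𝓘(ℝ, E₁) ∞ M₁] [IsManifold 𝓘(ℝ, E₂) ∞ M₂] [IsManifold 𝓘(ℝ, E) ∞ M]

/-- Take curves `c₁`, `c₂` with initial velocities `u`, `v` and the surface `q (c₁ t₁, c₂ t₂)`. The
curves need not be integral curves: on the axis `t₁ = 0` the first partial is always `D (u, 0)`
based over the fixed point `x₁`, and symmetrically on the other axis. -/
theorem dForm_reducedSystem_eq_zero {q : M₁ × M₂ → M}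
    (hq : ContMDiff (𝓘(ℝ, E₁).prod 𝓘(ℝ, E₂)) 𝓘(ℝ, E) ∞ q) {U : Set M} (hU : IsOpen U)
    {θ : OneForm 𝓘(ℝ, E) M} (hθ : SmoothFormOn θ U)
    (hθK : ∀ y ∈ U, θ y ∈ reducedSystem (I' := 𝓘(ℝ, E)) q (sumSystem K₁ K₂) y)
    {x₁ : M₁} {x₂ : M₂} (hx : q (x₁, x₂) ∈ U) {u : E₁} {v : E₂}
    (hu : u ∈ ann K₁ x₁) (hv : v ∈ ann K₂ x₂) :
    dForm θ (q (x₁, x₂)) (mfderiv (𝓘(ℝ, E₁).prod 𝓘(ℝ, E₂)) 𝓘(ℝ, E) q (x₁, x₂) (u, (0 : E₂)))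
      (mfderiv (𝓘(ℝ, E₁).prod 𝓘(ℝ, E₂)) 𝓘(ℝ, E) q (x₁, x₂) ((0 : E₁), v)) = 0 := by
  have : IsManifold 𝓘(ℝ, E₁) 1 M₁ := IsManifold.of_le (n := ∞) (by simp)
  have : IsManifold 𝓘(ℝ, E₂) 1 M₂ := IsManifold.of_le (n := ∞) (by simp)
  obtain ⟨c₁, hc₁, rfl, rfl⟩ := exists_curve_velocity x₁ u
  obtain ⟨c₂, hc₂, rfl, rfl⟩ := exists_curve_velocity x₂ v
  set S : ℝ × ℝ → M := fun t ↦ q (c₁ t.1, c₂ t.2) with hS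
  have hSsm : ContMDiffAt (𝓘(ℝ, ℝ).prod 𝓘(ℝ, ℝ)) 𝓘(ℝ, E) ∞ S 0 :=
    contMDiffAt_mul_curves hq hc₁ hc₂
  have hd : ∀ᶠ τ in 𝓝 (0 : ℝ), MDifferentiableAt 𝓘(ℝ, ℝ) 𝓘(ℝ, E₁) c₁ τ :=
    ((contMDiffAt_iff_contMDiffAt_nhds (n := 1) (by simp)).1
      (hc₁.of_le (by exact_mod_cast le_top))).mono fun w hw ↦ hw.mdifferentiableAt one_ne_zero
  have hd' : ∀ᶠ τ in 𝓝 (0 : ℝ), MDifferentiableAt 𝓘(ℝ, ℝ) 𝓘(ℝ, E₂) c₂ τ :=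
    ((contMDiffAt_iff_contMDiffAt_nhds (n := 1) (by simp)).1
      (hc₂.of_le (by exact_mod_cast le_top))).mono fun w hw ↦ hw.mdifferentiableAt one_ne_zero
  have hUS : ∀ a : ℝ × ℝ, ∀ᶠ τ in 𝓝 (0 : ℝ), S ((0 : ℝ × ℝ) + τ • a) ∈ U := fun a ↦ by
    have hl : Filter.Tendsto (fun τ : ℝ ↦ (0 : ℝ × ℝ) + τ • a) (𝓝 0) (𝓝 0) := by
      have : Continuous fun τ : ℝ ↦ (0 : ℝ × ℝ) + τ • a := by fun_prop
      simpa using this.tendsto 0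
    exact hl.eventually (hSsm.continuousAt.eventually (hU.mem_nhds hx))
  have hqd : ∀ p, MDifferentiableAt (𝓘(ℝ, E₁).prod 𝓘(ℝ, E₂)) 𝓘(ℝ, E) q p := fun p ↦
    hq.mdifferentiable (by simp) p
  have key := dForm_eq_zero_of_surface (z := 0) hSsm (hθ _ hx) (1, 0) (0, 1) ?_ ?_
  · have e₁ := mfderiv_mul_curves (z := 0) (hqd _) hd.self_of_nhds hd'.self_of_nhds 1 0
    have e₂ := mfderiv_mul_curves (z := 0) (hqd _) hd.self_of_nhds hd'.self_of_nhds 0 1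
    simp only [one_smul, zero_smul] at e₁ e₂
    refine Eq.trans ?_ key
    exact congrArg₂ (fun a b : E ↦ dForm θ (S 0) a b) e₁.symm e₂.symm
  · filter_upwards [hUS (0, 1), hd'] with τ h₁ h₂
    have e := mfderiv_mul_curves (z := (0, τ)) (hqd _) hd.self_of_nhds h₂ 1 0
    simp only [one_smul, zero_smul] at e
    have hz : (0 : ℝ × ℝ) + τ • ((0, 1) : ℝ × ℝ) = (0, τ) := by simp
    rw [hz] at h₁ ⊢
    refine (congrArg (fun w : E ↦ θ (S (0, τ)) w) e).trans ?_
    exact mfderiv_mem_ann_reducedSystem q _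
      (mem_ann_sumSystem.2 ⟨hu, Submodule.zero_mem _⟩) _ (hθK _ h₁)
  · filter_upwards [hUS (1, 0), hd] with τ h₁ h₂
    have e := mfderiv_mul_curves (z := (τ, 0)) (hqd _) h₂ hd'.self_of_nhds 0 1
    simp only [one_smul, zero_smul] at e
    have hz : (0 : ℝ × ℝ) + τ • ((1, 0) : ℝ × ℝ) = (τ, 0) := by simp
    rw [hz] at h₁ ⊢
    refine (congrArg (fun w : E ↦ θ (S (τ, 0)) w) e).trans ?_
    exact mfderiv_mem_ann_reducedSystem q _
      (mem_ann_sumSystem.2 ⟨Submodule.zero_mem _, hv⟩) _ (hθK _ h₁)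

end Systems

end Pfaff

/-! ### Factor directions are characteristic -/

namespace Pfaff

section Characteristic

variable {E₁ : Type*} [NormedAddCommGroup E₁] [NormedSpace ℝ E₁] [FiniteDimensional ℝ E₁]
  {M₁ : Type*} [TopologicalSpace M₁] [ChartedSpace E₁ M₁] [IsManifold 𝓘(ℝ, E₁) ∞ M₁]
  {E₂ : Type*} [NormedAddCommGroup E₂] [NormedSpace ℝ E₂] [FiniteDimensional ℝ E₂]
  {M₂ : Type*} [TopologicalSpace M₂] [ChartedSpace E₂ M₂] [IsManifold 𝓘(ℝ, E₂) ∞ M₂]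
  {E : Type*} [NormedAddCommGroup E] [NormedSpace ℝ E]
  {M : Type*} [TopologicalSpace M] [ChartedSpace E M] [IsManifold 𝓘(ℝ, E) ∞ M]
  {K₁ : CotangentSystem 𝓘(ℝ, E₁) M₁} {K₂ : CotangentSystem 𝓘(ℝ, E₂) M₂}

/-- The structure equations turn the vanishing of `dθ` between the factors into the orthogonality
relations of the linear algebra lemma. Which singular system occurs is left open; a
non-characteristic velocity avoids both annihilators. -/
theorem IsHyperbolic.mfderiv_factor_mem_ann {q : M₁ × M₂ → M}
    (hq : ContMDiff (𝓘(ℝ, E₁).prod 𝓘(ℝ, E₂)) 𝓘(ℝ, E) ∞ q) {V₁ V₂ : CotangentSystem 𝓘(ℝ, E) M}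
    {n : ℕ} (hK : IsHyperbolic (reducedSystem (I' := 𝓘(ℝ, E)) q (sumSystem K₁ K₂)) n V₁ V₂)
    {x₁ : M₁} {x₂ : M₂} (h₁ : 2 ≤ Module.finrank ℝ (ann K₁ x₁))
    (h₂ : 2 ≤ Module.finrank ℝ (ann K₂ x₂))
    (hinj : ∀ u : E₁, u ∈ ann K₁ x₁ → ∀ v : E₂, v ∈ ann K₂ x₂ →
      (mfderiv (𝓘(ℝ, E₁).prod 𝓘(ℝ, E₂)) 𝓘(ℝ, E) q (x₁, x₂) (u, v) : E) = 0 → u = 0 ∧ v = 0) :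
    ((∀ u : E₁, u ∈ ann K₁ x₁ →
        (mfderiv (𝓘(ℝ, E₁).prod 𝓘(ℝ, E₂)) 𝓘(ℝ, E) q (x₁, x₂) (u, (0 : E₂)) : E) ∈
          ann V₁ (q (x₁, x₂))) ∨
      (∀ u : E₁, u ∈ ann K₁ x₁ →
        (mfderiv (𝓘(ℝ, E₁).prod 𝓘(ℝ, E₂)) 𝓘(ℝ, E) q (x₁, x₂) (u, (0 : E₂)) : E) ∈
          ann V₂ (q (x₁, x₂)))) ∧
    ((∀ v : E₂, v ∈ ann K₂ x₂ →
        (mfderiv (𝓘(ℝ, E₁).prod 𝓘(ℝ, E₂)) 𝓘(ℝ, E) q (x₁, x₂) ((0 : E₁), v) : E) ∈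
          ann V₁ (q (x₁, x₂))) ∨
      (∀ v : E₂, v ∈ ann K₂ x₂ →
        (mfderiv (𝓘(ℝ, E₁).prod 𝓘(ℝ, E₂)) 𝓘(ℝ, E) q (x₁, x₂) ((0 : E₁), v) : E) ∈
          ann V₂ (q (x₁, x₂)))) := by
  obtain ⟨hn, hK⟩ := hK
  obtain ⟨U, hU, hyU, θ, ω₁, π₁, ω₂, π₂, hc, hV⟩ := hK (q (x₁, x₂))
  set y := q (x₁, x₂) with hy
  let D : E₁ × E₂ →L[ℝ] E := mfderiv (𝓘(ℝ, E₁).prod 𝓘(ℝ, E₂)) 𝓘(ℝ, E) q (x₁, x₂)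
  let P₁ : Submodule ℝ E₁ := ann K₁ x₁
  let P₂ : Submodule ℝ E₂ := ann K₂ x₂
  let Θ : Fin n → E →L[ℝ] ℝ := fun i ↦ θ i y
  let A : Fin 4 → E →L[ℝ] ℝ := ![ω₁ y, π₁ y, ω₂ y, π₂ y]
  have hspan : Submodule.span ℝ (Set.range (Sum.elim Θ A)) = ⊤ := hc.span_eq_top y hyU
  have hθK : ∀ i, ∀ z ∈ U, θ i z ∈ reducedSystem (I' := 𝓘(ℝ, E)) q (sumSystem K₁ K₂) z :=
    fun i z hz ↦ (hc.eq_span z hz).symm ▸ Submodule.subset_span ⟨i, rfl⟩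
  have hann : ∀ u ∈ P₁, ∀ v ∈ P₂,
      D (u, v) ∈ ann (reducedSystem (I' := 𝓘(ℝ, E)) q (sumSystem K₁ K₂)) y := fun u hu v hv ↦
    mfderiv_mem_ann_reducedSystem q _ (mem_ann_sumSystem.2 ⟨hu, hv⟩)
  have hΘ : ∀ u ∈ P₁, ∀ v ∈ P₂, ∀ i, Θ i (D (u, v)) = 0 := fun u hu v hv i ↦
    hann u hu v hv _ (hθK i y hyU)
  have hd : ∀ u ∈ P₁, ∀ v ∈ P₂, ∀ i, dForm (θ i) y (D (u, 0)) (D (0, v)) = 0 :=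
    fun u hu v hv i ↦ dForm_reducedSystem_eq_zero hq hU (hc.smooth_θ i) (hθK i) hyU hu hv
  have hB₁ : ∀ u ∈ P₁, ∀ v ∈ P₂,
      A 0 (D (u, 0)) * A 1 (D (0, v)) - A 0 (D (0, v)) * A 1 (D (u, 0)) = 0 :=
    -- With indices starting at 0, the last two forms have indices `n - 2` and `n - 1`; `2 ≤ n`
    -- makes both valid.
    fun u hu v hv ↦ (hc.d_fst y hyU ⟨n - 2, by omega⟩ (by simp only; omega) _
      (hann u hu 0 P₂.zero_mem) _ (hann 0 P₁.zero_mem v hv)).symm.trans (hd u hu v hv _)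
  have hB₂ : ∀ u ∈ P₁, ∀ v ∈ P₂,
      A 2 (D (u, 0)) * A 3 (D (0, v)) - A 2 (D (0, v)) * A 3 (D (u, 0)) = 0 :=
    fun u hu v hv ↦ (hc.d_snd y hyU ⟨n - 1, by omega⟩ (by simp only; omega) _
      (hann u hu 0 P₂.zero_mem) _ (hann 0 P₁.zero_mem v hv)).symm.trans (hd u hu v hv _)
  have hV₁ : ∀ w : E, (∀ i, Θ i w = 0) → A 0 w = 0 ∧ A 1 w = 0 → w ∈ ann V₁ y := by
    intro w hw hA
    refine ann_span _ V₁ (hV y hyU).1 ?_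
    rintro _ (⟨i, rfl⟩ | rfl | rfl)
    exacts [hw i, hA.2, hA.1]
  have hV₂ : ∀ w : E, (∀ i, Θ i w = 0) → A 2 w = 0 ∧ A 3 w = 0 → w ∈ ann V₂ y := by
    intro w hw hA
    refine ann_span _ V₂ (hV y hyU).2 ?_
    rintro _ (⟨i, rfl⟩ | rfl | rfl)
    exacts [hw i, hA.2, hA.1]
  constructor
  -- The linear algebra concerns the second factor, so the factors are swapped here; this only
  -- changes signs in the wedge relations.
  · have := vanish_on_snd_of_coframe ((D : E₁ × E₂ →ₗ[ℝ] E) ∘ₗ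
        (LinearEquiv.prodComm ℝ E₂ E₁ : E₂ × E₁ →ₗ[ℝ] E₁ × E₂)) (P₁ := P₂) (P₂ := P₁) h₂ h₁
      (fun v hv u hu h ↦ (hinj u hu v hv h).symm) Θ A hspan (fun v hv u hu ↦ hΘ u hu v hv)
      (fun v hv u hu ↦ by
        have := hB₁ u hu v hv
        change A 0 (D (0, v)) * A 1 (D (u, 0)) - A 0 (D (u, 0)) * A 1 (D (0, v)) = 0
        linarith)
      (fun v hv u hu ↦ by
        have := hB₂ u hu v hv
        change A 2 (D (0, v)) * A 3 (D (u, 0)) - A 2 (D (u, 0)) * A 3 (D (0, v)) = 0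
        linarith)
    exact this.imp
      (fun h u hu ↦ hV₁ _ (hΘ u hu 0 P₂.zero_mem) (h u hu))
      (fun h u hu ↦ hV₂ _ (hΘ u hu 0 P₂.zero_mem) (h u hu))
  · exact (vanish_on_snd_of_coframe (D : E₁ × E₂ →ₗ[ℝ] E) (P₁ := P₁) (P₂ := P₂) h₁ h₂ hinj Θ A
      hspan hΘ hB₁ hB₂).imp
      (fun h v hv ↦ hV₁ _ (hΘ 0 P₁.zero_mem v hv) (h v hv))
      (fun h v hv ↦ hV₂ _ (hΘ 0 P₁.zero_mem v hv) (h v hv))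

end Characteristic

theorem isOpen_openInterval (a b : EReal) : IsOpen (openInterval a b) :=
  (isOpen_lt continuous_const continuous_coe_real_ereal).inter
    (isOpen_lt continuous_coe_real_ereal continuous_const)

end Pfaff

/-! ### Solution of the Cauchy problem -/

theorem theorem5p3
    -- the manifolds `M₁`, `M₂`
    {E₁ : Type*} [NormedAddCommGroup E₁] [NormedSpace ℝ E₁] [FiniteDimensional ℝ E₁]
    {M₁ : Type*} [TopologicalSpace M₁] [ChartedSpace E₁ M₁] [IsManifold 𝓘(ℝ, E₁) ∞ M₁]
    {E₂ : Type*} [NormedAddCommGroup E₂] [NormedSpace ℝ E₂] [FiniteDimensional ℝ E₂]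
    {M₂ : Type*} [TopologicalSpace M₂] [ChartedSpace E₂ M₂] [IsManifold 𝓘(ℝ, E₂) ∞ M₂]
    -- the Lie group `G`, acting smoothly on `M₁` and `M₂`
    {E₀ : Type*} [NormedAddCommGroup E₀] [NormedSpace ℝ E₀] [FiniteDimensional ℝ E₀]
    {G : Type*} [TopologicalSpace G] [ChartedSpace E₀ G] [Group G] [LieGroup 𝓘(ℝ, E₀) ∞ G]
    [MulAction G M₁] [ContMDiffSMul 𝓘(ℝ, E₀) 𝓘(ℝ, E₁) ∞ G M₁]
    [MulAction G M₂] [ContMDiffSMul 𝓘(ℝ, E₀) 𝓘(ℝ, E₂) ∞ G M₂]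
    -- the quotient manifolds `B₁ = M₁ / G`, `B₂ = M₂ / G` and `M = (M₁ × M₂) / G_diag`
    {F₁ : Type*} [NormedAddCommGroup F₁] [NormedSpace ℝ F₁] [FiniteDimensional ℝ F₁]
    {B₁ : Type*} [TopologicalSpace B₁] [ChartedSpace F₁ B₁] [IsManifold 𝓘(ℝ, F₁) ∞ B₁]
    {F₂ : Type*} [NormedAddCommGroup F₂] [NormedSpace ℝ F₂] [FiniteDimensional ℝ F₂]
    {B₂ : Type*} [TopologicalSpace B₂] [ChartedSpace F₂ B₂] [IsManifold 𝓘(ℝ, F₂) ∞ B₂]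
    {E : Type*} [NormedAddCommGroup E] [NormedSpace ℝ E] [FiniteDimensional ℝ E]
    {M : Type*} [TopologicalSpace M] [ChartedSpace E M] [IsManifold 𝓘(ℝ, E) ∞ M]
    (q₁ : M₁ → B₁) (q₂ : M₂ → B₂) (q : M₁ × M₂ → M)
    -- the Darboux integrable hyperbolic system `K` on `M`, with singular systems `V₁`, `V₂`
    (K V₁ V₂ : CotangentSystem 𝓘(ℝ, E) M) (n : ℕ) (hK : IsHyperbolic K n V₁ V₂)
    (hD : IsDarbouxIntegrable K V₁ V₂)
    -- its canonical quotient representation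
    (K₁ : CotangentSystem 𝓘(ℝ, E₁) M₁) (K₂ : CotangentSystem 𝓘(ℝ, E₂) M₂)
    (hQ : IsCanonicalQuotientRepresentation F₁ F₂ G K₁ K₂ q₁ q₂ q K)
    -- the non-characteristic integral curve `γ : (a, b) → M`
    (a b : EReal) (γ : ℝ → M)
    (hγ : IsNonCharacteristicCurveOn 𝓘(ℝ, E) K V₁ V₂ γ (openInterval a b))
    -- the lift `σ` of `γ` to an integral curve of `K₁ + K₂`
    (σ : ℝ → M₁ × M₂)
    (hσ : IsIntegralManifoldOn 𝓘(ℝ, ℝ) (𝓘(ℝ, E₁).prod 𝓘(ℝ, E₂)) (sumSystem K₁ K₂) σ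
      (openInterval a b))
    (hlift : ∀ t ∈ openInterval a b, q (σ t) = γ t) :
    SolvesCauchyProblem 𝓘(ℝ, E) K γ (openInterval a b)
      (fun t : ℝ × ℝ ↦ q ((σ t.1).1, (σ t.2).2))
      (openInterval a b ×ˢ openInterval a b) := by
  have : IsManifold 𝓘(ℝ, E₁) 1 M₁ := IsManifold.of_le (n := ∞) (by simp)
  have : IsManifold 𝓘(ℝ, E₂) 1 M₂ := IsManifold.of_le (n := ∞) (by simp)
  set J := openInterval a b with hJ
  have hJo : IsOpen J := isOpen_openInterval a b
  obtain rfl := hQ.eq_reduced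
  have hq := hQ.regular_diag.smooth
  have hqd : ∀ p, MDifferentiableAt (𝓘(ℝ, E₁).prod 𝓘(ℝ, E₂)) 𝓘(ℝ, E) q p := fun p ↦
    hq.mdifferentiable (by simp) p
  have hσs : ∀ t ∈ J, ContMDiffAt 𝓘(ℝ, ℝ) (𝓘(ℝ, E₁).prod 𝓘(ℝ, E₂)) ∞ σ t := fun t ht ↦
    hσ.smooth.contMDiffAt (hJo.mem_nhds ht)
  have hσ₁ : ∀ t ∈ J, ContMDiffAt 𝓘(ℝ, ℝ) 𝓘(ℝ, E₁) ∞ (fun t ↦ (σ t).1) t := fun t ht ↦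
    (hσs t ht).fst
  have hσ₂ : ∀ t ∈ J, ContMDiffAt 𝓘(ℝ, ℝ) 𝓘(ℝ, E₂) ∞ (fun t ↦ (σ t).2) t := fun t ht ↦
    (hσs t ht).snd
  have hd₁ : ∀ t ∈ J, MDifferentiableAt 𝓘(ℝ, ℝ) 𝓘(ℝ, E₁) (fun t ↦ (σ t).1) t := fun t ht ↦
    (hσ₁ t ht).mdifferentiableAt (by simp)
  have hd₂ : ∀ t ∈ J, MDifferentiableAt 𝓘(ℝ, ℝ) 𝓘(ℝ, E₂) (fun t ↦ (σ t).2) t := fun t ht ↦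
    (hσ₂ t ht).mdifferentiableAt (by simp)
  have hvσ : ∀ t ∈ J, (velocity (𝓘(ℝ, E₁).prod 𝓘(ℝ, E₂)) σ t : E₁ × E₂) =
      ((velocity 𝓘(ℝ, E₁) (fun t ↦ (σ t).1) t : E₁),
        (velocity 𝓘(ℝ, E₂) (fun t ↦ (σ t).2) t : E₂)) := fun t ht ↦
    DFunLike.congr_fun ((hd₁ t ht).mfderiv_prod (hd₂ t ht)) (1 : ℝ)
  have hann : ∀ t ∈ J, (velocity 𝓘(ℝ, E₁) (fun t ↦ (σ t).1) t : E₁) ∈ ann K₁ (σ t).1 ∧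
      (velocity 𝓘(ℝ, E₂) (fun t ↦ (σ t).2) t : E₂) ∈ ann K₂ (σ t).2 := by
    intro t ht
    refine (mem_ann_sumSystem (E₁ := E₁) (E₂ := E₂)).1 fun α hα ↦ ?_
    have h := DFunLike.congr_fun (hσ.pullback_eq_zero t ht α hα) (1 : ℝ)
    exact (congrArg (fun w : E₁ × E₂ ↦ α w) (hvσ t ht)).symm.trans h
  have hvγ : ∀ t ∈ J, (velocity 𝓘(ℝ, E) γ t : E) =
      mfderiv (𝓘(ℝ, E₁).prod 𝓘(ℝ, E₂)) 𝓘(ℝ, E) q (σ t)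
        ((velocity 𝓘(ℝ, E₁) (fun t ↦ (σ t).1) t : E₁),
          (velocity 𝓘(ℝ, E₂) (fun t ↦ (σ t).2) t : E₂)) := by
    intro t ht
    have heq : γ =ᶠ[𝓝 t] q ∘ σ := by
      filter_upwards [hJo.mem_nhds ht] with τ hτ using (hlift τ hτ).symm
    have h₁ : (velocity 𝓘(ℝ, E) γ t : E) = velocity 𝓘(ℝ, E) (q ∘ σ) t :=
      DFunLike.congr_fun heq.mfderiv_eq (1 : ℝ)
    have h₂ := DFunLike.congr_fun
      (mfderiv_comp t (hqd (σ t)) ((hσs t ht).mdifferentiableAt (by simp))) (1 : ℝ)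
    exact h₁.trans (h₂.trans (congrArg (fun w : E₁ × E₂ ↦
      (mfderiv (𝓘(ℝ, E₁).prod 𝓘(ℝ, E₂)) 𝓘(ℝ, E) q (σ t) w : E)) (hvσ t ht)))
  have htr : ∀ (x₁ : M₁) (x₂ : M₂) (u : E₁), u ∈ ann K₁ x₁ → ∀ v : E₂, v ∈ ann K₂ x₂ →
      (mfderiv (𝓘(ℝ, E₁).prod 𝓘(ℝ, E₂)) 𝓘(ℝ, E) q (x₁, x₂) (u, v) : E) = 0 → u = 0 ∧ v = 0 := by
    intro x₁ x₂ u hu v hv h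
    -- Derived systems are smaller, so their annihilators are larger: transversality to `K₁' + K₂'`
    -- implies transversality to `K₁ + K₂`.
    have h0 := hQ.transverse_diag (x₁, x₂) ((u, v) : E₁ × E₂)
      (mem_ann_sumSystem.2 ⟨fun α hα ↦ hu α (derivedSystem_le K₁ _ hα),
        fun α hα ↦ hv α (derivedSystem_le K₂ _ hα)⟩) h
    exact Prod.mk_eq_zero.1 h0
  obtain ⟨r₁, hr₁, hP₁⟩ := hQ.codim_fst
  obtain ⟨r₂, hr₂, hP₂⟩ := hQ.codim_snd
  have hrank₁ : ∀ x, 2 ≤ Module.finrank ℝ (ann K₁ x) := fun x ↦ by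
    have := hP₁.finrank_le_ann x
    omega
  have hrank₂ : ∀ x, 2 ≤ Module.finrank ℝ (ann K₂ x) := fun x ↦ by
    have := hP₂.finrank_le_ann x
    omega
  have hne : ∀ t ∈ J, (velocity 𝓘(ℝ, E₁) (fun t ↦ (σ t).1) t : E₁) ≠ 0 ∧
      (velocity 𝓘(ℝ, E₂) (fun t ↦ (σ t).2) t : E₂) ≠ 0 := by
    intro t ht
    have hchar := hK.mfderiv_factor_mem_ann hq (hrank₁ (σ t).1) (hrank₂ (σ t).2) (htr _ _)
    -- Treating the velocity as a vector `w` of `E` allows the base point to change from `γ t` to `q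
    -- (σ t)`.
    have hV : ∀ V : CotangentSystem 𝓘(ℝ, E) M, velocity 𝓘(ℝ, E) γ t ∉ ann V (γ t) →
        ∀ w : E, (velocity 𝓘(ℝ, E) γ t : E) = w → w ∉ ann V (q (σ t)) := by
      rintro V hV _ rfl
      rw [hlift t ht]
      exact hV
    have hV₁ := hV V₁ (hγ.not_mem_ann_fst t ht) _ (hvγ t ht)
    have hV₂ := hV V₂ (hγ.not_mem_ann_snd t ht) _ (hvγ t ht)
    -- When one component vanishes, the velocity of `γ` is the image of the other factor alone,
    -- hence characteristic.
    constructor <;> intro h0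
    · rw [h0] at hV₁ hV₂
      exact hchar.2.elim (fun h ↦ hV₁ (h _ (hann t ht).2)) (fun h ↦ hV₂ (h _ (hann t ht).2))
    · rw [h0] at hV₁ hV₂
      exact hchar.1.elim (fun h ↦ hV₁ (h _ (hann t ht).1)) (fun h ↦ hV₂ (h _ (hann t ht).1))
  refine ⟨⟨fun z hz ↦ ?_, fun z hz ↦ ?_, fun z hz α hα ↦ ?_⟩, ?_⟩
  · exact (contMDiffAt_mul_curves (c₁ := fun t ↦ (σ t).1) (c₂ := fun t ↦ (σ t).2) hq
      (hσ₁ _ hz.1) (hσ₂ _ hz.2)).contMDiffWithinAt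
  · refine (injective_iff_map_eq_zero _).2 ?_
    rintro ⟨x, y⟩ hxy
    have h := (mfderiv_mul_curves (c₁ := fun t ↦ (σ t).1) (c₂ := fun t ↦ (σ t).2) (hqd _)
      (hd₁ _ hz.1) (hd₂ _ hz.2) x y).symm.trans hxy
    obtain ⟨h₁, h₂⟩ := htr _ _ _ (Submodule.smul_mem _ x (hann _ hz.1).1) _
      (Submodule.smul_mem _ y (hann _ hz.2).2) h
    exact Prod.ext ((smul_eq_zero (M := E₁).1 h₁).resolve_right (hne _ hz.1).1)
      ((smul_eq_zero (M := E₂).1 h₂).resolve_right (hne _ hz.2).2)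
  · ext ⟨x, y⟩
    refine (congrArg (fun w : E ↦ α w) (mfderiv_mul_curves (c₁ := fun t ↦ (σ t).1)
      (c₂ := fun t ↦ (σ t).2) (hqd _) (hd₁ _ hz.1) (hd₂ _ hz.2) x y)).trans ?_
    exact mfderiv_mem_ann_reducedSystem (p := ((σ z.1).1, (σ z.2).2)) q _
      ((mem_ann_sumSystem (E₁ := E₁) (E₂ := E₂)).2
      ⟨Submodule.smul_mem _ x (hann _ hz.1).1, Submodule.smul_mem _ y (hann _ hz.2).2⟩) α hα
  · rintro _ ⟨t, ht, rfl⟩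
    exact ⟨(t, t), ⟨ht, ht⟩, hlift t ht⟩
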